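/- Write $\mathbb{R}_{\max}=\mathbb{R}\cup\{-\infty\}$ for the max-plus semiring and $\mathbb{P}^{n-1}=\mathbb{R}^n/(1,\dots,1)\mathbb{R}$. Let $\mathcal{C}$ be the real polyhedral cone generated by $v^1,\dots,v^p\in\mathbb{R}^n$, that is, the set of all vectors of $\mathbb{R}_{\max}^n$ of the form $\left(\max_{r}(\lambda_r+v^r_i)\right)_{i\in[n]}$ with $\lambda_1,\dots,\lambda_p\in\mathbb{R}_{\max}$. For $a\in\mathbb{R}^n$ and a non-empty proper subset $I\subset[n]$, the half-space with apex $a$ and sectors $I$ is $$\mathcal{H}(a,I)=\{x\in\mathbb{R}_{\max}^n : \max_{i\in I}(x_i-a_i)\ge\max_{j\in[n]\setminus I}(x_j-a_j)\};$$ it depends only on $I$ and on the class of $a$ in $\mathbb{P}^{n-1}$. Let $\Sigma$ be the set of half-spaces $\mathcal{H}(a,I)$ that contain $\mathcal{C}$ and whose apex $a$ belongs to $\mathcal{C}$. A non-redundant external representation of $\mathcal{C}$ is a finite set $\Gamma\subset\Sigma$ with $\mathcal{C}=\bigcap_{\mathcal{H}\in\Gamma}\mathcal{H}$ and $\bigcap_{\mathcal{H}'\in\Gamma\setminus\{\mathcal{H}\}}\mathcal{H}'\not\subset\mathcal{H}$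 for every $\mathcal{H}\in\Gamma$. Let $\partial\mathcal{C}$ be the boundary of (the image of) $\mathcal{C}$ in $\mathbb{P}^{n-1}$, and for $a\in\partial\mathcal{C}$ let $\Sigma_a$ be the set of half-spaces with apex $a$ that contain $\mathcal{C}$. For $X\subset\partial\mathcal{C}$ let $\tau'(X)$ be the set of all $a\in\partial\mathcal{C}$ such that every half-space in $\Sigma_a$ contains $\bigcap_{b\in X}\bigcap_{\mathcal{H}\in\Sigma_b}\mathcal{H}$. Call $a$ a non-redundant apex of $\mathcal{C}$ if it belongs to the inclusion-minimal finite set $\mathcal{A}\subset\partial\mathcal{C}$ with $\tau'(\mathcal{A})=\partial\mathcal{C}$, or if it is the apex of a half-space of some non-redundant external representation of $\mathcal{C}$ (the two conditions are known to be equivalent; the theorem is asserted under either). The type of $x\in\mathbb{R}^n$ is $(S_1(x),\dots,S_n(x))$, where $S_j(x)=\{r\in[p] : v^r_j-x_j\ge v^r_i-x_i \text{ for all } i\in[n]\}$. The natural cell decomposition of $\mathbb{P}^{n-1}$ induced by $v^1,\dots,v^p$ consists of the convex polyhedra $X_S=\{x\in\mathbb{P}^{n-1} : S_j\subset S_j(x)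 \text{ for all } j\in[n]\}$, where $S$ ranges over all types; its vertices are its zero-dimensional cells. For a non-empty proper subset $I\subset[n]$ and $j\in[n]\setminus I$, a vector $a\in\mathbb{R}^n$ is an $(I,j)$-vertex of $\mathcal{C}$ if 1. $\bigcup_{i\in I}S_i(a)=[p]$; 2. for each $k\in[n]\setminus I$ there is $i\in I$ with $S_i(a)\cap S_k(a)\ne\emptyset$; 3. $S_i(a)\cap S_j(a)\not\subset\bigcup_{k\in I\setminus\{i\}}S_k(a)$ for all $i\in I$. **Theorem.** For every non-redundant apex $a$ of $\mathcal{C}$ there exist a non-empty proper subset $I\subset[n]$ and $j\in[n]\setminus I$ such that $a$ is an $(I,j)$-vertex of $\mathcal{C}$. In particular, every non-redundant apex of $\mathcal{C}$ is a vertex of the natural cell decomposition of $\mathbb{P}^{n-1}$ induced by $v^1,\dots,v^p$. -/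

import Mathlib

/-! Max-plus convexity. The max-plus semiring is `WithBot ℝ`, with `⊔` as tropical addition, `+` as
tropical multiplication, and `⊥` as the tropical zero. Tropical cones and half-spaces are subsets of
`Fin n → WithBot ℝ` that are closed under tropical scaling. -/

namespace TropCone

open Set

noncomputable section

/-- The real projective space `ℝⁿ / (1, …, 1)ℝ`. -/
abbrev ProjSpace (n : ℕ) : Type :=
  (Fin n → ℝ) ⧸ (Submodule.span ℝ {(1 : Fin n → ℝ)})

/-- The point of the real projective space represented by a vector of `ℝⁿ`. -/
def proj {n : ℕ} (x : Fin n → ℝ) : ProjSpace n :=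
  Submodule.Quotient.mk x

/-- The inclusion of `ℝⁿ` in the `n`-fold product of the max-plus semiring. -/
def toMax {n : ℕ} (x : Fin n → ℝ) : Fin n → WithBot ℝ :=
  fun i => (x i : WithBot ℝ)

/-- The tropical cone generated by `v 0, …, v (p - 1)`: all tropical linear combinations of them. -/
def cone {n p : ℕ} (v : Fin p → Fin n → ℝ) : Set (Fin n → WithBot ℝ) :=
  {x | ∃ c : Fin p → WithBot ℝ,
    ∀ i, x i = Finset.univ.sup fun r => c r + (v r i : WithBot ℝ)}

/-- The tropical sum over `i ∈ I` of `(a i)⁻¹ (x i)`, that is, the maximum of `x i - a i`. -/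
def pairing {n : ℕ} (a : Fin n → ℝ) (I : Finset (Fin n)) (x : Fin n → WithBot ℝ) : WithBot ℝ :=
  I.sup fun i => x i + ((-a i : ℝ) : WithBot ℝ)

/-- The half-space with apex `a` and set of sectors `I`. It is a non-degenerate tropical half-space
when `I` is non-empty and proper. -/
def halfSpace {n : ℕ} (a : Fin n → ℝ) (I : Finset (Fin n)) : Set (Fin n → WithBot ℝ) :=
  {x | pairing a Iᶜ x ≤ pairing a I x}

/-- The half-spaces with apex `b` that contain `C`. -/
def halfSpacesAt {n : ℕ} (C : Set (Fin n → WithBot ℝ)) (b : ProjSpace n) :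
    Set (Set (Fin n → WithBot ℝ)) :=
  {H | C ⊆ H ∧ ∃ (a : Fin n → ℝ) (I : Finset (Fin n)),
    proj a = b ∧ I.Nonempty ∧ I ≠ Finset.univ ∧ H = halfSpace a I}

/-- The image in the real projective space of the real vectors of `C`. -/
def projImage {n : ℕ} (C : Set (Fin n → WithBot ℝ)) : Set (ProjSpace n) :=
  proj '' {x | toMax x ∈ C}

/-- The half-spaces that contain `C` and have their apex in `C`. -/
def supporting {n : ℕ} (C : Set (Fin n → WithBot ℝ)) : Set (Set (Fin n → WithBot ℝ)) :=
  ⋃ b ∈ projImage C, halfSpacesAt C b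

/-- The half-spaces containing `C`, with apex in `C`, that are implied by (redundant with respect
to) those in `Γ`. -/
def implied {n : ℕ} (C : Set (Fin n → WithBot ℝ)) (Γ : Set (Set (Fin n → WithBot ℝ))) :
    Set (Set (Fin n → WithBot ℝ)) :=
  {H | H ∈ supporting C ∧ ⋂₀ Γ ⊆ H}

/-- `Γ` is a non-redundant external representation of `C`. -/
structure IsNonredundantRep {n : ℕ} (C : Set (Fin n → WithBot ℝ))
    (Γ : Set (Set (Fin n → WithBot ℝ))) : Prop where
  finite : Γ.Finite
  subset : Γ ⊆ supporting C
  eq_sInter : C = ⋂₀ Γ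
  nonredundant : ∀ H ∈ Γ, H ∉ implied C (Γ \ {H})

/-- The boundary of `C` in the real projective space. -/
def boundary {n : ℕ} (C : Set (Fin n → WithBot ℝ)) : Set (ProjSpace n) :=
  frontier (projImage C)

/-- The closure operator on subsets of the boundary of `C` induced by redundancy: the boundary
points `a` such that every half-space with apex `a` containing `C` is implied by the half-spaces
containing `C` with apex in `X`. -/
def apexClosure {n : ℕ} (C : Set (Fin n → WithBot ℝ)) (X : Set (ProjSpace n)) :
    Set (ProjSpace n) :=
  {a | a ∈ boundary C ∧ halfSpacesAt C a ⊆ implied C (⋃ b ∈ X, halfSpacesAt C b)}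

/-- `X` is a finite spanning set of the boundary of `C` for `apexClosure C`. -/
def IsFiniteSpanning {n : ℕ} (C : Set (Fin n → WithBot ℝ)) (X : Set (ProjSpace n)) : Prop :=
  X.Finite ∧ X ⊆ boundary C ∧ apexClosure C X = boundary C

/-- The non-redundant apices of `C`: the elements of the inclusion-minimal finite spanning set of
the boundary of `C`. (For a real polyhedral cone there is exactly one such set, so that "the"
minimal set and the union of all minimal sets agree.) -/
def nonredundantApices {n : ℕ} (C : Set (Fin n → WithBot ℝ)) : Set (ProjSpace n) :=
  ⋃₀ {X | Minimal (IsFiniteSpanning C) X}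

/-- The type `(S_j(x))_j` of `x` relative to the family `v`. -/
def type {n p : ℕ} (v : Fin p → Fin n → ℝ) (x : Fin n → ℝ) : Fin n → Set (Fin p) :=
  fun j => {r | ∀ i, v r i - x i ≤ v r j - x j}

/-- The set `X_S` of the points whose type contains `S`; it is a cell of the natural cell
decomposition when `S` is a type. -/
def cell {n p : ℕ} (v : Fin p → Fin n → ℝ) (S : Fin n → Set (Fin p)) : Set (ProjSpace n) :=
  proj '' {x | ∀ j, S j ⊆ type v x j}

/-- `a` is a vertex (zero-dimensional cell) of the natural cell decomposition of the real projective
space induced by `v`. The dimension of a cell is that of its affine hull. -/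
def IsCellVertex {n p : ℕ} (v : Fin p → Fin n → ℝ) (a : ProjSpace n) : Prop :=
  ∃ S : Fin n → Set (Fin p), (∃ x, S = type v x) ∧ a ∈ cell v S ∧
    Module.finrank ℝ (vectorSpan ℝ (cell v S)) = 0

/-- `a` is an `(I, j)`-vertex of the cone generated by `v`. -/
structure IsIJVertex {n p : ℕ} (v : Fin p → Fin n → ℝ) (I : Finset (Fin n)) (j : Fin n)
    (a : Fin n → ℝ) : Prop where
  nonempty : I.Nonempty
  proper : I ≠ Finset.univ
  notMem : j ∉ I
  cover : ⋃ i ∈ I, type v a i = univ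
  meet : ∀ k ∉ I, ∃ i ∈ I, (type v a i ∩ type v a k).Nonempty
  tight : ∀ i ∈ I, ¬ type v a i ∩ type v a j ⊆ ⋃ k ∈ I \ {i}, type v a k

end

end TropCone

namespace TropCone

open Set

variable {n p : ℕ}

/-! ### Projective space -/

/-! Two facts carry the proof. The first (`exists_isIJVertex_separating`) is that a real point
outside the cone is cut off by a half-space whose apex is an $(I,j)$-vertex: the failing inequality
in a coordinate $j$ is weakened by raising apex coordinates and dropping sectors until each
remaining sector is indispensable, and then the coordinates outside $I$ are pushed down as far as
the generators allow.

The second (`exists_isIJVertex_proj_eq`) is a perturbation argument. Let $D$ be cut out by the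
half-spaces kept when those at $a$ are removed, and let $x\in D$ violate a half-space at $a$. The
combination $y$ of $a$ and a multiple of $x$ lies in $D$, outside the cone, and as close to $a$ as
desired. Some vertex $b$ separates $y$ from the cone. A type that occurs at a vertex determines it,
so vertices not equivalent to $a$ are at least some $\varepsilon$ away from $a$. If $b$ were one of
these, adding a multiple of $b$ to $y$ would give a point of $D$ that still violates the half-space
at $b$, yet satisfies every half-space at $a$, because the $b$ term dominates there. That is
impossible, so $b$ is $a$ up to scaling.

Both notions of non-redundant apex supply such a $D$ and $x$. The cell statement follows since the
type of a vertex pins it down. -/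

theorem proj_eq_iff {x y : Fin n → ℝ} :
    proj x = proj y ↔ ∀ i k, x i - y i = x k - y k := by
  unfold proj
  rw [Submodule.Quotient.eq, Submodule.mem_span_singleton]
  constructor
  · rintro ⟨c, hc⟩ i k
    have h1 := congrFun hc i
    have h2 := congrFun hc k
    simp only [Pi.smul_apply, Pi.one_apply, Pi.sub_apply, smul_eq_mul] at h1 h2
    linarith
  · intro h
    rcases isEmpty_or_nonempty (Fin n) with hn | ⟨⟨k⟩⟩
    · exact ⟨0, Subsingleton.elim _ _⟩
    · refine ⟨x k - y k, funext fun i => ?_⟩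
      simp [h i k]

theorem exists_sub_pos_of_proj_ne {x y : Fin n → ℝ} (h : proj x ≠ proj y) :
    ∃ i k, 0 < (x i - y i) - (x k - y k) := by
  contrapose! h
  exact proj_eq_iff.2 fun i k => le_antisymm (by linarith [h i k]) (by linarith [h k i])

/-! ### Half-spaces -/

theorem mem_halfSpace {a : Fin n → ℝ} {I : Finset (Fin n)} {x : Fin n → WithBot ℝ} :
    x ∈ halfSpace a I ↔ ∀ k ∉ I, x k ≠ ⊥ →
      ∃ i ∈ I, x k + ((-a k : ℝ) : WithBot ℝ) ≤ x i + ((-a i : ℝ) : WithBot ℝ) := by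
  simp only [halfSpace, pairing, mem_ofPred_eq, Finset.sup_le_iff, Finset.mem_compl]
  refine forall₂_congr fun k _ => ?_
  by_cases hx : x k = ⊥
  · simp [hx]
  · rw [Finset.le_sup_iff]
    · simp [hx]
    · rw [bot_lt_iff_ne_bot]
      simp [hx]

theorem toMax_mem_halfSpace {a x : Fin n → ℝ} {I : Finset (Fin n)} :
    toMax x ∈ halfSpace a I ↔ ∀ k ∉ I, ∃ i ∈ I, x k - a k ≤ x i - a i := by
  rw [mem_halfSpace]
  refine forall₂_congr fun k _ => ?_
  simp only [toMax, ne_eq, WithBot.coe_ne_bot, not_false_eq_true, forall_true_left,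
    ← WithBot.coe_add, WithBot.coe_le_coe, sub_eq_add_neg]

theorem pairing_sup (a : Fin n → ℝ) (I : Finset (Fin n)) (x y : Fin n → WithBot ℝ) :
    pairing a I (x ⊔ y) = pairing a I x ⊔ pairing a I y := by
  simp only [pairing, Pi.sup_apply, ← Finset.sup_sup]
  refine Finset.sup_congr rfl fun i _ => ?_
  exact max_add_add_right _ _ _ |>.symm

theorem sup_mem_halfSpace {a : Fin n → ℝ} {I : Finset (Fin n)} {x y : Fin n → WithBot ℝ}
    (hx : x ∈ halfSpace a I) (hy : y ∈ halfSpace a I) : x ⊔ y ∈ halfSpace a I := by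
  simp only [halfSpace, mem_ofPred_eq, pairing_sup] at *
  exact sup_le_sup hx hy

theorem add_mem_halfSpace {a : Fin n → ℝ} {I : Finset (Fin n)} {x : Fin n → WithBot ℝ}
    (hx : x ∈ halfSpace a I) (c : ℝ) : (fun i => x i + (c : WithBot ℝ)) ∈ halfSpace a I := by
  rw [mem_halfSpace] at *
  intro k hk hxk
  obtain ⟨i, hi, h⟩ := hx k hk (by rintro h; simp [h] at hxk)
  refine ⟨i, hi, ?_⟩
  rw [add_right_comm, add_right_comm (x i)]
  gcongr

theorem halfSpace_congr {a b : Fin n → ℝ} (h : proj a = proj b) (I : Finset (Fin n)) :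
    halfSpace a I = halfSpace b I := by
  rw [proj_eq_iff] at h
  have key : ∀ {a b : Fin n → ℝ}, (∀ i k, a i - b i = a k - b k) →
      halfSpace a I ⊆ halfSpace b I := by
    intro a b h x hx
    rw [mem_halfSpace] at *
    intro k hk hxk
    obtain ⟨i, hi, hik⟩ := hx k hk hxk
    refine ⟨i, hi, ?_⟩
    have e : ∀ l, x l + ((-b l : ℝ) : WithBot ℝ)
        = x l + ((-a l : ℝ) : WithBot ℝ) + ((a k - b k : ℝ) : WithBot ℝ) := by
      intro l
      rw [add_assoc, ← WithBot.coe_add, ← h l k]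
      congr 2
      ring
    rw [e, e i]
    gcongr
  refine subset_antisymm (key h) (key fun i k => ?_)
  linarith [h i k]

theorem single_mem_halfSpace_iff {a : Fin n → ℝ} {I : Finset (Fin n)} {k : Fin n} :
    (fun l => if l = k then (0 : WithBot ℝ) else ⊥) ∈ halfSpace a I ↔ k ∈ I := by
  rw [mem_halfSpace]
  constructor
  · intro h
    by_contra hk
    obtain ⟨i, hi, hik⟩ := h k hk (by simp)
    have : i ≠ k := by rintro rfl; exact hk hi
    simp [this] at hik
  · intro hk l hl hlk
    have : l ≠ k := by rintro rfl; exact hl hk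
    simp [this] at hlk

/-- Vectors with two finite entries are test points that recover the differences of apex coordinates
across $I$ and its complement. -/
theorem pair_mem_halfSpace_iff {a : Fin n → ℝ} {I : Finset (Fin n)} {i k : Fin n}
    (hi : i ∈ I) (hk : k ∉ I) (s : ℝ) :
    (fun l => if l = i then (s : WithBot ℝ) else if l = k then (0 : WithBot ℝ) else ⊥)
      ∈ halfSpace a I ↔ a i - a k ≤ s := by
  have hki : k ≠ i := by rintro rfl; exact hk hi
  rw [mem_halfSpace]
  constructor
  · intro h
    obtain ⟨l, hl, hlk⟩ := h k hk (by simp [hki])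
    have hlk' : l ≠ k := by rintro rfl; exact hk hl
    by_cases hli : l = i
    · subst hli
      simp only [hki, if_true, if_false] at hlk
      rw [zero_add, ← WithBot.coe_add, WithBot.coe_le_coe] at hlk
      linarith
    · simp [hki, hlk', hli] at hlk
  · intro h l hl hx
    have hli : l ≠ i := by rintro rfl; exact hl hi
    by_cases hlk : l = k
    · subst hlk
      refine ⟨i, hi, ?_⟩
      simp only [hki, if_true, if_false]
      rw [zero_add, ← WithBot.coe_add, WithBot.coe_le_coe]
      linarith
    · simp [hli, hlk] at hx

/-- A non-degenerate half-space determines its apex in the projective space. -/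
theorem proj_eq_of_halfSpace_eq {a b : Fin n → ℝ} {I J : Finset (Fin n)} (hI : I.Nonempty)
    (hI' : I ≠ Finset.univ) (h : halfSpace a I = halfSpace b J) : proj a = proj b := by
  obtain rfl : I = J := by
    ext k
    rw [← single_mem_halfSpace_iff (a := a), h, single_mem_halfSpace_iff]
  have key : ∀ i ∈ I, ∀ k ∉ I, a i - a k = b i - b k := by
    intro i hi k hk
    have e : ∀ s, a i - a k ≤ s ↔ b i - b k ≤ s := fun s => by
      rw [← pair_mem_halfSpace_iff (a := a) hi hk, h, pair_mem_halfSpace_iff hi hk]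
    exact le_antisymm ((e _).2 le_rfl) ((e _).1 le_rfl)
  obtain ⟨i₀, hi₀⟩ := hI
  obtain ⟨k₀, hk₀⟩ : ∃ k, k ∉ I := by
    by_contra! hc
    exact hI' (Finset.eq_univ_iff_forall.2 hc)
  -- Differences across $I$ and its complement suffice: any two indices are linked through $i_0$ and
  -- $k_0$.
  have base : ∀ l, a l - b l = a k₀ - b k₀ := by
    intro l
    by_cases hl : l ∈ I
    · linarith [key l hl k₀ hk₀]
    · linarith [key i₀ hi₀ k₀ hk₀, key i₀ hi₀ l hl]
  exact proj_eq_iff.2 fun i k => (base i).trans (base k).symm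

/-! ### Cones -/

/-- Residuation: the greatest multiple of $v^r$ below $x$ has coefficient $\min_k(x_k-v^r_k)$, and
it touches $x$ at coordinate $j$ exactly when $r\in S_j(x)$. -/
theorem toMax_mem_cone_iff {v : Fin p → Fin n → ℝ} {x : Fin n → ℝ} :
    toMax x ∈ cone v ↔ ∀ j, (type v x j).Nonempty := by
  constructor
  · rintro ⟨c, hc⟩ j
    have hp : (Finset.univ : Finset (Fin p)).Nonempty := by
      rw [Finset.nonempty_iff_ne_empty]
      intro he
      have := hc j
      simp [he, toMax] at this
    obtain ⟨r, -, hr⟩ := Finset.exists_mem_eq_sup Finset.univ hp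
      fun r => c r + (v r j : WithBot ℝ)
    rw [← hc j] at hr
    refine ⟨r, fun i => ?_⟩
    have hi : c r + (v r i : WithBot ℝ) ≤ toMax x i := by
      rw [hc i]
      exact Finset.le_sup (f := fun r => c r + (v r i : WithBot ℝ)) (Finset.mem_univ r)
    cases hcr : c r with
    | bot => simp [hcr, toMax] at hr
    | coe t =>
      rw [hcr] at hi hr
      simp only [toMax, ← WithBot.coe_add, WithBot.coe_le_coe, WithBot.coe_inj] at hi hr
      linarith
  · intro h
    rcases isEmpty_or_nonempty (Fin n) with hn | hn
    · exact ⟨fun _ => ⊥, fun i => isEmptyElim i⟩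
    · refine ⟨fun r => ((Finset.univ.inf' Finset.univ_nonempty fun k => x k - v r k : ℝ) :
        WithBot ℝ), fun i => le_antisymm ?_ (Finset.sup_le fun r _ => ?_)⟩
      · obtain ⟨r, hr⟩ := h i
        refine le_trans ?_ (Finset.le_sup (Finset.mem_univ r))
        rw [← WithBot.coe_add, toMax, WithBot.coe_le_coe, ← sub_le_iff_le_add]
        refine Finset.le_inf' _ _ fun k _ => ?_
        linarith [hr k]
      · rw [← WithBot.coe_add, toMax, WithBot.coe_le_coe, ← le_sub_iff_add_le]
        exact Finset.inf'_le (fun k => x k - v r k) (Finset.mem_univ i)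

theorem cone_subset_halfSpace {v : Fin p → Fin n → ℝ} {a : Fin n → ℝ} {I : Finset (Fin n)}
    (h : ⋃ i ∈ I, type v a i = univ) : cone v ⊆ halfSpace a I := by
  rintro x ⟨c, hc⟩
  rw [mem_halfSpace]
  intro k _ hxk
  have hp : (Finset.univ : Finset (Fin p)).Nonempty := by
    rw [Finset.nonempty_iff_ne_empty]
    intro he
    rw [hc k, he] at hxk
    exact hxk rfl
  obtain ⟨r, -, hr⟩ := Finset.exists_mem_eq_sup Finset.univ hp
    fun r => c r + (v r k : WithBot ℝ)
  rw [← hc k] at hr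
  obtain ⟨i, hi, hri⟩ := mem_iUnion₂.1 (h ▸ mem_univ r : r ∈ ⋃ i ∈ I, type v a i)
  refine ⟨i, hi, ?_⟩
  have hxi : c r + (v r i : WithBot ℝ) ≤ x i := by
    rw [hc i]
    exact Finset.le_sup (f := fun r => c r + (v r i : WithBot ℝ)) (Finset.mem_univ r)
  calc x k + ((-a k : ℝ) : WithBot ℝ) = c r + ((v r k - a k : ℝ) : WithBot ℝ) := by
        rw [hr, add_assoc, ← WithBot.coe_add, sub_eq_add_neg]
    _ ≤ c r + ((v r i - a i : ℝ) : WithBot ℝ) := by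
        gcongr
        exact WithBot.coe_le_coe.2 (hri k)
    _ = c r + (v r i : WithBot ℝ) + ((-a i : ℝ) : WithBot ℝ) := by
        rw [add_assoc, ← WithBot.coe_add, sub_eq_add_neg]
    _ ≤ x i + ((-a i : ℝ) : WithBot ℝ) := by gcongr

/-! ### The boundary -/

theorem proj_preimage_projImage_cone (v : Fin p → Fin n → ℝ) :
    proj ⁻¹' projImage (cone v) = {x | toMax x ∈ cone v} := by
  refine Subset.antisymm ?_ fun x hx => ⟨x, hx, rfl⟩
  rintro x ⟨y, hy, hyx⟩
  have hy' : toMax y ∈ cone v := hy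
  change toMax x ∈ cone v
  rw [toMax_mem_cone_iff] at *
  refine fun j => (hy' j).imp fun r hr i => ?_
  linarith [hr i, proj_eq_iff.1 hyx i j]

theorem proj_mem_boundary_iff {v : Fin p → Fin n → ℝ} {a : Fin n → ℝ} :
    proj a ∈ boundary (cone v) ↔ a ∈ frontier {x | toMax x ∈ cone v} := by
  have hq := Submodule.isOpenQuotientMap_mkQ (Submodule.span ℝ {(1 : Fin n → ℝ)})
  rw [← proj_preimage_projImage_cone]
  exact Set.ext_iff.1
    (hq.isOpenMap.preimage_frontier_eq_frontier_preimage hq.continuous (projImage (cone v))) a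

theorem isClosed_setOf_toMax_mem_cone (v : Fin p → Fin n → ℝ) :
    IsClosed {x | toMax x ∈ cone v} := by
  have h : {x | toMax x ∈ cone v} = ⋂ j, ⋃ r, ⋂ i, {x | v r i - x i ≤ v r j - x j} := by
    ext x
    simp only [mem_iInter, mem_iUnion]
    exact toMax_mem_cone_iff
  rw [h]
  refine isClosed_iInter fun j => isClosed_iUnion_of_finite fun r => isClosed_iInter fun i => ?_
  exact isClosed_le (by fun_prop) (by fun_prop)

theorem toMax_mem_cone_of_proj_mem_boundary {v : Fin p → Fin n → ℝ} {a : Fin n → ℝ}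
    (h : proj a ∈ boundary (cone v)) : toMax a ∈ cone v :=
  (isClosed_setOf_toMax_mem_cone v).frontier_subset (proj_mem_boundary_iff.1 h)

/-! ### The vertices attached to sectors -/

namespace IsIJVertex

variable {v : Fin p → Fin n → ℝ} {I : Finset (Fin n)} {j : Fin n} {a : Fin n → ℝ}

theorem toMax_mem_cone (h : IsIJVertex v I j a) : toMax a ∈ cone v := by
  rw [toMax_mem_cone_iff]
  intro k
  by_cases hk : k ∈ I
  · obtain ⟨r, hr, -⟩ := not_subset.1 (h.tight k hk)
    exact ⟨r, hr.1⟩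
  · obtain ⟨i, -, r, hr⟩ := h.meet k hk
    exact ⟨r, hr.2⟩

theorem cone_subset (h : IsIJVertex v I j a) : cone v ⊆ halfSpace a I :=
  cone_subset_halfSpace h.cover

/-- The type of `a` determines `a` up to scaling. -/
theorem proj_eq_of_type_subset (h : IsIJVertex v I j a) {x : Fin n → ℝ}
    (hx : ∀ k, type v a k ⊆ type v x k) : proj x = proj a := by
  have key : ∀ i k, (type v a i ∩ type v a k).Nonempty → x i - a i = x k - a k := by
    rintro i k ⟨r, hi, hk⟩
    linarith [hi k, hk i, hx i hi k, hx k hk i]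
  have hI : ∀ i ∈ I, x i - a i = x j - a j := by
    intro i hi
    obtain ⟨r, hr, -⟩ := not_subset.1 (h.tight i hi)
    exact key i j ⟨r, hr⟩
  have hall : ∀ k, x k - a k = x j - a j := by
    intro k
    by_cases hk : k ∈ I
    · exact hI k hk
    · obtain ⟨i, hi, hik⟩ := h.meet k hk
      exact (key i k hik).symm.trans (hI i hi)
  exact proj_eq_iff.2 fun i k => (hall i).trans (hall k).symm

theorem isCellVertex (h : IsIJVertex v I j a) : IsCellVertex v (proj a) := by
  have hc : cell v (type v a) = {proj a} := by
    refine Subset.antisymm ?_ (singleton_subset_iff.2 ⟨a, fun _ => Subset.rfl, rfl⟩)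
    rintro _ ⟨x, hx, rfl⟩
    exact h.proj_eq_of_type_subset hx
  refine ⟨type v a, ⟨a, rfl⟩, hc ▸ mem_singleton _, ?_⟩
  rw [hc, vectorSpan_singleton, finrank_bot]

theorem congr (h : IsIJVertex v I j a) {b : Fin n → ℝ} (hab : proj b = proj a) :
    IsIJVertex v I j b := by
  have ht : type v b = type v a := by
    rw [proj_eq_iff] at hab
    ext k r
    refine forall_congr' fun i => ?_
    constructor <;> intro h <;> linarith [hab i k]
  exact ⟨h.nonempty, h.proper, h.notMem, by rw [ht]; exact h.cover, by rw [ht]; exact h.meet,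
    by rw [ht]; exact h.tight⟩

/-- Increasing coordinate $j\notin I$ alone leaves the half-space at once: on $I$ all $x_i-a_i$ stay
$0$. -/
theorem proj_mem_boundary (h : IsIJVertex v I j a) : proj a ∈ boundary (cone v) := by
  rw [proj_mem_boundary_iff, frontier]
  refine ⟨subset_closure h.toMax_mem_cone, fun hint => ?_⟩
  rw [mem_interior_iff_mem_nhds] at hint
  have hcont : Filter.Tendsto (fun t : ℝ => a + Pi.single j t) (nhds 0) (nhds a) := by
    have : Continuous fun t : ℝ => a + Pi.single j t :=
      continuous_const.add (continuous_single (A := fun _ : Fin n => ℝ) j)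
    simpa using this.tendsto 0
  obtain ⟨ε, hε, hball⟩ := Metric.eventually_nhds_iff.1 (hcont.eventually hint)
  have hmem := hball (y := ε / 2) (by
    rw [Real.dist_eq, sub_zero, abs_of_pos (by linarith)]
    linarith)
  obtain ⟨i, hi, hji⟩ := toMax_mem_halfSpace.1 (h.cone_subset hmem) j h.notMem
  have hij : i ≠ j := by rintro rfl; exact h.notMem hi
  simp [hij] at hji
  linarith

/-- The vertices with a different class stay at a positive distance from a given point, in
Hilbert's seminorm. -/
theorem exists_pos_forall_le (v : Fin p → Fin n → ℝ) (a : Fin n → ℝ) :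
    ∃ ε > 0, ∀ I j b, IsIJVertex v I j b → proj b ≠ proj a →
      ∃ i k, ε ≤ (b i - a i) - (b k - a k) := by
  -- There are finitely many types, and all vertices of a given type are equivalent, so one positive
  -- bound per type is enough.
  have hS : ∀ S : Fin n → Set (Fin p), ∃ ε > 0, ∀ I j b, IsIJVertex v I j b → proj b ≠ proj a →
      type v b = S → ∃ i k, ε ≤ (b i - a i) - (b k - a k) := by
    intro S
    by_cases hex : ∃ I j b, IsIJVertex v I j b ∧ proj b ≠ proj a ∧ type v b = S
    · obtain ⟨I, j, b, hb, hba, rfl⟩ := hex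
      obtain ⟨i, k, hik⟩ := exists_sub_pos_of_proj_ne hba
      refine ⟨_, hik, fun I' j' b' _ _ ht => ⟨i, k, ?_⟩⟩
      have := proj_eq_iff.1 (hb.proj_eq_of_type_subset (x := b') fun k => (congrFun ht k).ge) i k
      linarith
    · exact ⟨1, one_pos, fun I j b hb hba ht => (hex ⟨I, j, b, hb, hba, ht⟩).elim⟩
  choose ε hε hle using hS
  obtain ⟨S₀, hS₀⟩ := Finite.exists_min ε
  refine ⟨ε S₀, hε S₀, fun I j b hb hba => ?_⟩
  obtain ⟨i, k, hik⟩ := hle (type v b) I j b hb hba rfl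
  exact ⟨i, k, (hS₀ _).trans hik⟩

end IsIJVertex

/-- An inequality that bounds the coordinate `j` of the `v r` can be weakened until each of the
remaining sectors in `T` is, for some `r`, the only one at which equality is attained. -/
theorem exists_tight_weights (v : Fin p → Fin n → ℝ) (j : Fin n) (y : Fin n → ℝ)
    (hy : ∀ r, ∃ k, k ≠ j ∧ v r j - y j ≤ v r k - y k) (T : Finset (Fin n)) :
    ∃ (I : Finset (Fin n)) (b : Fin n → ℝ), j ∉ I ∧ b j = y j ∧ (∀ k, y k ≤ b k) ∧
      (∀ r, ∃ k ∈ I, v r j - b j ≤ v r k - b k) ∧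
      ∀ i ∈ I, i ∈ T → ∃ r, v r i - b i = v r j - b j ∧
        ∀ k ∈ I, k ≠ i → v r k - b k < v r j - b j := by
  induction T using Finset.induction_on with
  | empty =>
    refine ⟨Finset.univ.erase j, y, by simp, rfl, fun _ => le_rfl, fun r => ?_, by simp⟩
    obtain ⟨k, hk, hle⟩ := hy r
    exact ⟨k, by simp [hk], hle⟩
  | insert i T _ ih =>
    obtain ⟨I, b, hj, hbj, hyb, hval, htight⟩ := ih
    by_cases hi : i ∈ I
    swap
    · refine ⟨I, b, hj, hbj, hyb, hval, fun i' hi' hT => htight i' hi' ?_⟩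
      refine (Finset.mem_insert.1 hT).resolve_left ?_
      rintro rfl
      exact hi hi'
    classical
    -- The generators for which sector $i$ cannot be spared. If there are none, $i$ is dropped.
    let R : Finset (Fin p) :=
      Finset.univ.filter fun r => ∀ k ∈ I, k ≠ i → v r k - b k < v r j - b j
    have hR : ∀ r, r ∉ R → ∃ k ∈ I, k ≠ i ∧ v r j - b j ≤ v r k - b k := by
      intro r hr
      simpa [R] using hr
    rcases R.eq_empty_or_nonempty with hRe | hRn
    · refine ⟨I.erase i, b, fun h => hj (Finset.mem_of_mem_erase h), hbj, hyb, fun r => ?_,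
        fun i' hi' hT => ?_⟩
      · obtain ⟨k, hk, hki, hle⟩ := hR r (by simp [hRe])
        exact ⟨k, Finset.mem_erase.2 ⟨hki, hk⟩, hle⟩
      · obtain ⟨hne, hi'⟩ := Finset.mem_erase.1 hi'
        obtain ⟨r, hr, hlt⟩ := htight i' hi' ((Finset.mem_insert.1 hT).resolve_left hne)
        exact ⟨r, hr, fun k hk => hlt k (Finset.mem_of_mem_erase hk)⟩
    · obtain ⟨r₀, hr₀, hmin⟩ := R.exists_min_image (fun r => v r i - v r j) hRn
      have hr₀' : ∀ k ∈ I, k ≠ i → v r₀ k - b k < v r₀ j - b j := (Finset.mem_filter.1 hr₀).2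
      have hji : j ≠ i := by rintro rfl; exact hj hi
      -- The largest value of the coordinate $b_i$ that keeps the inequality for all of `R`;
      -- equality holds at $r_0$. Raising $b_i$ only lowers the terms of sector $i$, so earlier
      -- tightness witnesses survive.
      set t : ℝ := v r₀ i - v r₀ j + b j with ht
      have hbt : b i ≤ t := by
        obtain ⟨k, hk, hle⟩ := hval r₀
        by_cases hki : k = i
        · subst hki; linarith
        · linarith [hr₀' k hk hki]
      refine ⟨I, Function.update b i t, hj, ?_, fun k => ?_, fun r => ?_, fun i' hi' hT => ?_⟩
      · simp [hji, hbj]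
      · by_cases hki : k = i
        · subst hki; simpa using (hyb k).trans hbt
        · simpa [hki] using hyb k
      · by_cases hr : r ∈ R
        · refine ⟨i, hi, ?_⟩
          simp only [Function.update_of_ne hji, Function.update_self]
          linarith [hmin r hr]
        · obtain ⟨k, hk, hki, hle⟩ := hR r hr
          exact ⟨k, hk, by simpa [hji, hki] using hle⟩
      · by_cases hii : i' = i
        · subst hii
          refine ⟨r₀, ?_, fun k hk hki => ?_⟩
          · simp only [Function.update_of_ne hji, Function.update_self]
            linarith
          · simpa [hji, hki] using hr₀' k hk hki
        · obtain ⟨r, hr, hlt⟩ := htight i' hi' ((Finset.mem_insert.1 hT).resolve_left hii)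
          refine ⟨r, by simpa [hji, hii] using hr, fun k hk hki => ?_⟩
          by_cases hk' : k = i
          · subst hk'
            have := hlt k hk hki
            simp only [Function.update_of_ne hji, Function.update_self]
            linarith
          · simpa [hji, hk'] using hlt k hk hki

/-- A weakest inequality extends to a vertex: the coordinates of the apex outside `I` are the
smallest ones for which the half-space contains the cone. -/
theorem exists_isIJVertex_of_tight [Nonempty (Fin p)] {v : Fin p → Fin n → ℝ}
    {I : Finset (Fin n)} {j : Fin n} {b : Fin n → ℝ} (hj : j ∉ I)
    (hval : ∀ r, ∃ k ∈ I, v r j - b j ≤ v r k - b k)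
    (htight : ∀ i ∈ I, ∃ r, v r i - b i = v r j - b j ∧
      ∀ k ∈ I, k ≠ i → v r k - b k < v r j - b j) :
    ∃ a, IsIJVertex v I j a ∧ a j = b j ∧ ∀ i ∈ I, a i = b i := by
  have hI : I.Nonempty := by
    obtain ⟨k, hk, -⟩ := hval (Classical.arbitrary _)
    exact ⟨k, hk⟩
  have hM : ∀ r, ∃ i ∈ I, ∀ k ∈ I, v r k - b k ≤ v r i - b i := fun r =>
    I.exists_max_image (fun k => v r k - b k) hI
  choose m hmI hm using hM
  have hs : ∀ k, ∃ r, ∀ r', v r' k - (v r' (m r') - b (m r')) ≤ v r k - (v r (m r) - b (m r)) :=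
    fun k => Finite.exists_max fun r => v r k - (v r (m r) - b (m r))
  choose s hs using hs
  classical
  let a : Fin n → ℝ := fun k =>
    if k ∈ I then b k else v (s k) k - (v (s k) (m (s k)) - b (m (s k)))
  have haI : ∀ i ∈ I, a i = b i := fun i hi => if_pos hi
  have haI' : ∀ k ∉ I, a k = v (s k) k - (v (s k) (m (s k)) - b (m (s k))) :=
    fun k hk => if_neg hk
  have hle : ∀ r k, v r k - a k ≤ v r (m r) - a (m r) := by
    intro r k
    rw [haI _ (hmI r)]
    by_cases hk : k ∈ I
    · rw [haI k hk]; exact hm r k hk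
    · rw [haI' k hk]; linarith [hs k r]
  have htype : ∀ r k, v r k - a k = v r (m r) - a (m r) → r ∈ type v a k :=
    fun r k h i => h ▸ hle r i
  -- The extremal formula off $I$ gives back $b_j$: validity bounds it above, and a tight generator
  -- attains it.
  have haj : a j = b j := by
    obtain ⟨i, hi⟩ := hI
    obtain ⟨r, hr, hlt⟩ := htight i hi
    obtain ⟨k, hk, hjk⟩ := hval (s j)
    refine le_antisymm ?_ ?_
    · rw [haI' j hj]
      linarith [hm (s j) k hk]
    · have hmr : v r (m r) - b (m r) ≤ v r j - b j := by
        by_cases hmi : m r = i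
        · rw [hmi, hr]
        · exact (hlt _ (hmI r) hmi).le
      rw [haI' j hj]
      linarith [hs j r]
  refine ⟨a, ⟨hI, ?_, hj, ?_, ?_, ?_⟩, haj, haI⟩
  · rintro rfl; exact hj (Finset.mem_univ _)
  · refine eq_univ_of_forall fun r => mem_iUnion₂.2 ⟨m r, hmI r, htype r _ rfl⟩
  · intro k hk
    refine ⟨m (s k), hmI _, s k, htype _ _ rfl, htype _ _ ?_⟩
    rw [haI' k hk, haI _ (hmI _)]
    ring
  · intro i hi hsub
    obtain ⟨r, hr, hlt⟩ := htight i hi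
    have hmi : m r = i := by
      by_contra hne
      linarith [hlt _ (hmI r) hne, hm r i hi]
    have hri : r ∈ type v a i := htype r i (by rw [hmi])
    have hrj : r ∈ type v a j := htype r j (by rw [hmi, haj, haI i hi, hr])
    obtain ⟨k, hk, hrk⟩ := mem_iUnion₂.1 (hsub ⟨hri, hrj⟩)
    obtain ⟨hkI, hki⟩ := Finset.mem_sdiff.1 hk
    rw [Finset.mem_singleton] at hki
    have := hrk i
    rw [haI i hi, haI k hkI] at this
    linarith [hlt k hkI hki]

/-- A real vector outside the cone is separated from it by a half-space whose apex is one of the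
vertices attached to its sectors. -/
theorem exists_isIJVertex_separating [Nonempty (Fin p)] {v : Fin p → Fin n → ℝ} {y : Fin n → ℝ}
    (hy : toMax y ∉ cone v) :
    ∃ I j a, IsIJVertex v I j a ∧ toMax y ∉ halfSpace a I := by
  simp only [toMax_mem_cone_iff, not_forall, not_nonempty_iff_eq_empty,
    eq_empty_iff_forall_notMem] at hy
  obtain ⟨j, hj⟩ := hy
  have hj' : ∀ r, ∃ k, v r j - y j < v r k - y k := by
    intro r
    by_contra! hc
    exact hj r hc
  choose m hm using hj'
  obtain ⟨r₀, hr₀⟩ := Finite.exists_min fun r => (v r (m r) - y (m r)) - (v r j - y j)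
  set ε := (v r₀ (m r₀) - y (m r₀)) - (v r₀ j - y j) with hε
  have hε0 : 0 < ε := by linarith [hm r₀]
  have hmj : ∀ r, m r ≠ j := fun r h => by
    have := hm r
    rw [h] at this
    exact lt_irrefl _ this
  -- Lowering $y_j$ by the least slack $\varepsilon$ keeps the inequality valid on the generators.
  -- At $y$ the term of $j$ is then $\varepsilon>0$, while those of $I$ are at most $0$.
  obtain ⟨I, b, hjI, hbj, hyb, hval, htight⟩ :=
    exists_tight_weights v j (Function.update y j (y j - ε)) (fun r => ⟨m r, hmj r, by
      simp only [Function.update_self, Function.update_of_ne (hmj r)]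
      linarith [hr₀ r]⟩) Finset.univ
  obtain ⟨a, ha, haj, haI⟩ := exists_isIJVertex_of_tight hjI hval
    fun i hi => htight i hi (Finset.mem_univ i)
  refine ⟨I, j, a, ha, fun hmem => ?_⟩
  obtain ⟨i, hi, hji⟩ := toMax_mem_halfSpace.1 hmem j hjI
  have hij : i ≠ j := by rintro rfl; exact hjI hi
  have h1 := hyb i
  rw [Function.update_of_ne hij] at h1
  rw [Function.update_self] at hbj
  rw [haj, haI i hi] at hji
  linarith

/-! ### Non-redundant apices -/

/-- If the half-spaces with apex `a` are needed to cut the cone out of a convex set `D`, then `a` is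
one of the vertices attached to sectors. -/
theorem exists_isIJVertex_proj_eq [Nonempty (Fin p)] {v : Fin p → Fin n → ℝ} {a : Fin n → ℝ}
    (ha : toMax a ∈ cone v) {D : Set (Fin n → WithBot ℝ)} (hsup : ∀ x ∈ D, ∀ y ∈ D, x ⊔ y ∈ D)
    (hadd : ∀ x ∈ D, ∀ c : ℝ, (fun i => x i + (c : WithBot ℝ)) ∈ D) (hCD : cone v ⊆ D)
    {F : Set (Finset (Fin n))} (hF : ∀ I ∈ F, cone v ⊆ halfSpace a I)
    (hD : ∀ z, toMax z ∈ D → (∀ I ∈ F, toMax z ∈ halfSpace a I) → toMax z ∈ cone v)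
    {x : Fin n → WithBot ℝ} (hx : x ∈ D) {I : Finset (Fin n)} (hI : I ∈ F)
    (hxI : x ∉ halfSpace a I) :
    ∃ J j, IsIJVertex v J j a := by
  obtain ⟨ε, hε, hosc⟩ := IsIJVertex.exists_pos_forall_le v a
  have hn : Nonempty (Fin n) := by
    by_contra hn
    exact hxI (mem_halfSpace.2 fun k => (hn ⟨k⟩).elim)
  obtain ⟨k, hk⟩ := Finite.exists_max fun k => x k + ((-a k : ℝ) : WithBot ℝ)
  have hlt : ∀ i ∈ I, x i + ((-a i : ℝ) : WithBot ℝ) < x k + ((-a k : ℝ) : WithBot ℝ) := by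
    intro i hi
    by_contra! hc
    exact hxI (mem_halfSpace.2 fun l _ _ => ⟨i, hi, (hk l).trans hc⟩)
  obtain ⟨t, ht⟩ : ∃ t : ℝ, x k = t := by
    refine (WithBot.ne_bot_iff_exists.1 fun hbot => hxI (mem_halfSpace.2 fun l _ hl => ?_)).imp
      fun _ => Eq.symm
    have := hk l
    simp [hbot, hl] at this
  have hkI : k ∉ I := fun h => lt_irrefl _ (hlt k h)
  -- With this scaling, $x+c-a$ has maximum exactly $\varepsilon$, attained at $k\notin I$ and not
  -- on $I$.
  set c : ℝ := ε - (t - a k) with hc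
  obtain ⟨y, hy⟩ : ∃ y : Fin n → ℝ, toMax y = toMax a ⊔ fun i => x i + (c : WithBot ℝ) := by
    have : ∀ i, ∃ s : ℝ, (s : WithBot ℝ) = (toMax a ⊔ fun i => x i + (c : WithBot ℝ)) i :=
      fun i => WithBot.ne_bot_iff_exists.1 (ne_bot_of_le_ne_bot WithBot.coe_ne_bot
        (le_sup_left : (a i : WithBot ℝ) ≤ _))
    choose y hy using this
    exact ⟨y, funext hy⟩
  have hyD : toMax y ∈ D := hy ▸ hsup _ (hCD ha) _ (hadd x hx c)
  have hay : ∀ i, a i ≤ y i := fun i => by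
    have := congrFun hy i
    exact WithBot.coe_le_coe.1 ((le_sup_left : (a i : WithBot ℝ) ≤ _).trans this.ge)
  have hyi : ∀ i, y i = a i ∨ x i = ((y i - c : ℝ) : WithBot ℝ) := fun i => by
    have h1 : (y i : WithBot ℝ) = max (a i : WithBot ℝ) (x i + (c : WithBot ℝ)) := congrFun hy i
    rcases max_choice (a i : WithBot ℝ) (x i + (c : WithBot ℝ)) with h | h
    · left; rw [h] at h1; exact WithBot.coe_inj.1 h1
    · right
      rw [h] at h1
      cases hxi : x i with
      | bot => simp [hxi] at h1
      | coe s =>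
        rw [hxi, ← WithBot.coe_add, WithBot.coe_inj] at h1
        rw [h1, add_sub_cancel_right]
  have hyle : ∀ i, y i ≤ a i + ε := fun i => by
    rcases hyi i with h | h
    · linarith
    · have := hk i
      simp only [h, ht, ← WithBot.coe_add, WithBot.coe_le_coe] at this
      linarith
  have hylt : ∀ i ∈ I, y i < a i + ε := fun i hi => by
    rcases hyi i with h | h
    · linarith
    · have := hlt i hi
      simp only [h, ht, ← WithBot.coe_add, WithBot.coe_lt_coe] at this
      linarith
  have hyk : a k + ε ≤ y k := by
    have h1 : x k + (c : WithBot ℝ) ≤ (y k : WithBot ℝ) :=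
      (le_sup_right : _ ≤ (a k : WithBot ℝ) ⊔ _).trans (congrFun hy k).ge
    rw [ht, ← WithBot.coe_add, WithBot.coe_le_coe] at h1
    linarith
  have hyC : toMax y ∉ cone v := fun h => by
    obtain ⟨i, hi, hik⟩ := toMax_mem_halfSpace.1 (hF I hI h) k hkI
    linarith [hylt i hi]
  obtain ⟨J, j, b, hb, hyb⟩ := exists_isIJVertex_separating hyC
  refine ⟨J, j, hb.congr ?_⟩
  by_contra hne
  obtain ⟨i₀, k₀, hik⟩ := hosc J j b hb (Ne.symm hne)
  rw [toMax_mem_halfSpace] at hyb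
  push Not at hyb
  obtain ⟨l, hl, hyl⟩ := hyb
  obtain ⟨m, hm⟩ := Finite.exists_max fun k => a k - b k
  obtain ⟨i₁, hi₁, hm₁⟩ : ∃ i ∈ J, a m - b m ≤ a i - b i := by
    by_cases hmJ : m ∈ J
    · exact ⟨m, hmJ, le_rfl⟩
    · exact toMax_mem_halfSpace.1 (hb.cone_subset ha) m hmJ
  -- The shift $a_m-b_m=\max(a-b)$ is attained on $J$, so it is at most $\max_J(y-b)$, and adding
  -- the multiple of $b$ does not repair the violation at $b$.
  let z : Fin n → ℝ := fun i => max (y i) (b i + (a m - b m))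
  have hz : toMax z = toMax y ⊔ fun i => toMax b i + ((a m - b m : ℝ) : WithBot ℝ) := by
    funext i
    simp [z, toMax]
  have hzD : toMax z ∈ D := hz ▸ hsup _ hyD _ (hadd _ (hCD hb.toMax_mem_cone) _)
  have hzC : toMax z ∉ cone v := fun h => by
    obtain ⟨i, hi, hil⟩ := toMax_mem_halfSpace.1 (hb.cone_subset h) l hl
    have h1 : y l ≤ z l := le_max_left _ _
    have h2 : z i < y l - b l + b i := max_lt (by linarith [hyl i hi])
      (by linarith [hyl i₁ hi₁, hay i₁])
    linarith
  obtain ⟨I₂, hI₂, hzI⟩ : ∃ I₂ ∈ F, toMax z ∉ halfSpace a I₂ := by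
    by_contra! hall
    exact hzC (hD z hzD hall)
  obtain ⟨M, hM⟩ := Finite.exists_max fun k => b k - a k
  obtain ⟨i₂, hi₂, hM₂⟩ : ∃ i ∈ I₂, b M - a M ≤ b i - a i := by
    by_cases hMI : M ∈ I₂
    · exact ⟨M, hMI, le_rfl⟩
    · exact toMax_mem_halfSpace.1 (hF I₂ hI₂ hb.toMax_mem_cone) M hMI
  -- $z-a$ at $i_2$ is at least $\max(b-a)+\max(a-b)\ge\varepsilon$, which bounds both $y-a$ and the
  -- shifted $b-a$ everywhere.
  refine hzI (toMax_mem_halfSpace.2 fun k' _ => ⟨i₂, hi₂, ?_⟩)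
  have h1 : b i₂ + (a m - b m) ≤ z i₂ := le_max_right _ _
  have h2 : z k' ≤ a k' + (b i₂ + (a m - b m) - a i₂) :=
    max_le (by linarith [hyle k', hm k₀, hM i₀]) (by linarith [hM k'])
  linarith

theorem exists_isIJVertex_of_isNonredundantRep {v : Fin p → Fin n → ℝ} {a : Fin n → ℝ}
    {Γ : Set (Set (Fin n → WithBot ℝ))} (hΓ : IsNonredundantRep (cone v) Γ)
    {I : Finset (Fin n)} (hI : I.Nonempty) (hI' : I ≠ Finset.univ) (hIΓ : halfSpace a I ∈ Γ) :
    ∃ J j, IsIJVertex v J j a := by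
  have hmem : ∀ H ∈ Γ, ∃ b K, toMax b ∈ cone v ∧ cone v ⊆ H ∧ H = halfSpace b K := by
    intro H hH
    obtain ⟨_, ⟨b, hb, rfl⟩, hCH, a', K, hab, -, -, rfl⟩ := mem_iUnion₂.1 (hΓ.subset hH)
    exact ⟨b, K, hb, hCH, halfSpace_congr hab K⟩
  obtain ⟨x, hx, hxI⟩ := not_subset.1 fun h => hΓ.nonredundant _ hIΓ ⟨hΓ.subset hIΓ, h⟩
  obtain ⟨b, K, hb, hCH, hab⟩ := hmem _ hIΓ
  have hproj := proj_eq_of_halfSpace_eq hI hI' hab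
  have hn : ∃ k, k ∉ I := by
    by_contra! hc
    exact hI' (Finset.eq_univ_iff_forall.2 hc)
  have hp : Nonempty (Fin p) := by
    obtain ⟨k, -⟩ := hn
    obtain ⟨r, -⟩ := toMax_mem_cone_iff.1 hb k
    exact ⟨r⟩
  rw [halfSpace_congr hproj I] at hCH hxI hx
  obtain ⟨J, j, hJ⟩ := exists_isIJVertex_proj_eq (D := ⋂₀ (Γ \ {halfSpace b I})) (F := {I}) hb
    (fun x hx y hy H hH => by
      obtain ⟨b, K, -, -, rfl⟩ := hmem H hH.1
      exact sup_mem_halfSpace (hx _ hH) (hy _ hH))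
    (fun x hx c H hH => by
      obtain ⟨b, K, -, -, rfl⟩ := hmem H hH.1
      exact add_mem_halfSpace (hx _ hH) c)
    (fun x hx H hH => by
      obtain ⟨_, _, -, h, -⟩ := hmem H hH.1
      exact h hx)
    (by simpa using hCH)
    (fun z hz hzI => by
      rw [hΓ.eq_sInter]
      intro H hH
      by_cases hHI : H = halfSpace b I
      · exact hHI ▸ hzI I rfl
      · exact hz H ⟨hH, hHI⟩)
    hx (mem_singleton I) hxI
  exact ⟨J, j, hJ.congr hproj⟩

theorem exists_isIJVertex_of_mem_nonredundantApices {v : Fin p → Fin n → ℝ} {a : Fin n → ℝ}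
    (ha : proj a ∈ nonredundantApices (cone v)) : ∃ J j, IsIJVertex v J j a := by
  obtain ⟨X, hX, haX⟩ := ha
  obtain ⟨hXfin, hXsub, hXcl⟩ := hX.prop
  have haC : toMax a ∈ cone v := toMax_mem_cone_of_proj_mem_boundary (hXsub haX)
  -- By minimality, removing $a$ loses some half-space at a boundary point. A point $x$ witnessing
  -- this must violate a half-space at $a$, since all of $X$ together implies the lost one.
  have hY : ¬ IsFiniteSpanning (cone v) (X \ {proj a}) := fun h =>
    (hX.le_of_le h sdiff_subset haX).2 rfl
  have hcl : ¬ boundary (cone v) ⊆ apexClosure (cone v) (X \ {proj a}) := fun h =>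
    hY ⟨hXfin.subset sdiff_subset, sdiff_subset.trans hXsub, Subset.antisymm (fun _ h => h.1) h⟩
  obtain ⟨b, hb, hbn⟩ := not_subset.1 hcl
  have himp : ∀ b ∈ boundary (cone v), halfSpacesAt (cone v) b ⊆
      implied (cone v) (⋃ c ∈ X, halfSpacesAt (cone v) c) := fun b hb => by
    rw [← hXcl] at hb
    exact hb.2
  obtain ⟨H, hH, hHn⟩ := not_subset.1 fun h => hbn ⟨hb, h⟩
  obtain ⟨x, hx, hxH⟩ := not_subset.1 fun h => hHn ⟨(himp b hb hH).1, h⟩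
  have hp : Nonempty (Fin p) := by
    obtain ⟨-, -, I, -, ⟨k, -⟩, -, -⟩ := hH
    obtain ⟨r, -⟩ := toMax_mem_cone_iff.1 haC k
    exact ⟨r⟩
  obtain ⟨I, ⟨hI, hI', hIC⟩, hxI⟩ : ∃ I ∈ {I : Finset (Fin n) | I.Nonempty ∧ I ≠ Finset.univ ∧
      cone v ⊆ halfSpace a I}, x ∉ halfSpace a I := by
    by_contra! hall
    refine hxH ((himp b hb hH).2 fun K hK => ?_)
    obtain ⟨c, hc, hKc⟩ := mem_iUnion₂.1 hK
    by_cases hca : c = proj a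
    · subst hca
      obtain ⟨hCK, a', I, haa, hI, hI', rfl⟩ := hKc
      rw [halfSpace_congr haa] at hCK ⊢
      exact hall I ⟨hI, hI', hCK⟩
    · exact hx K (mem_iUnion₂.2 ⟨c, ⟨hc, hca⟩, hKc⟩)
  have hmem : ∀ K ∈ ⋃ c ∈ X \ {proj a}, halfSpacesAt (cone v) c,
      cone v ⊆ K ∧ ∃ b I, K = halfSpace b I := by
    intro K hK
    obtain ⟨c, -, hCK, b, I, -, -, -, hKb⟩ := mem_iUnion₂.1 hK
    exact ⟨hCK, b, I, hKb⟩
  refine exists_isIJVertex_proj_eq (D := ⋂₀ ⋃ c ∈ X \ {proj a}, halfSpacesAt (cone v) c)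
    (F := {I : Finset (Fin n) | I.Nonempty ∧ I ≠ Finset.univ ∧ cone v ⊆ halfSpace a I}) haC
    (fun x hx y hy K hK => ?_) (fun x hx c K hK => ?_) (fun x hx K hK => (hmem K hK).1 hx)
    (fun I hI => hI.2.2) (fun z hz hzF => ?_) hx ⟨hI, hI', hIC⟩ hxI
  · obtain ⟨-, b, I, rfl⟩ := hmem K hK
    exact sup_mem_halfSpace (hx _ hK) (hy _ hK)
  · obtain ⟨-, b, I, rfl⟩ := hmem K hK
    exact add_mem_halfSpace (hx _ hK) c
  -- Vertices lie on the boundary, so a separating half-space at a vertex is implied by those with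
  -- apex in $X$.
  · by_contra hzC
    obtain ⟨J, j, b, hb, hzb⟩ := exists_isIJVertex_separating hzC
    refine hzb ((himp _ hb.proj_mem_boundary
      ⟨hb.cone_subset, b, J, rfl, hb.nonempty, hb.proper, rfl⟩).2 fun K hK => ?_)
    obtain ⟨c, hc, hKc⟩ := mem_iUnion₂.1 hK
    by_cases hca : c = proj a
    · subst hca
      obtain ⟨hCK, a', I, haa, hI, hI', rfl⟩ := hKc
      rw [halfSpace_congr haa] at hCK ⊢
      exact hzF I ⟨hI, hI', hCK⟩
    · exact hz K (mem_iUnion₂.2 ⟨c, ⟨hc, hca⟩, hKc⟩)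

end TropCone

theorem mainTheorem7 {n p : ℕ} (v : Fin p → Fin n → ℝ) (a : Fin n → ℝ)
    (ha : TropCone.proj a ∈ TropCone.nonredundantApices (TropCone.cone v) ∨
      ∃ Γ : Set (Set (Fin n → WithBot ℝ)), TropCone.IsNonredundantRep (TropCone.cone v) Γ ∧
        ∃ I : Finset (Fin n), I.Nonempty ∧ I ≠ Finset.univ ∧ TropCone.halfSpace a I ∈ Γ) :
    (∃ (I : Finset (Fin n)) (j : Fin n), I.Nonempty ∧ I ≠ Finset.univ ∧ j ∉ I ∧
      TropCone.IsIJVertex v I j a) ∧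
    TropCone.IsCellVertex v (TropCone.proj a) := by
  obtain ⟨J, j, hJ⟩ : ∃ J j, TropCone.IsIJVertex v J j a := by
    rcases ha with ha | ⟨Γ, hΓ, I, hI, hI', hIΓ⟩
    · exact TropCone.exists_isIJVertex_of_mem_nonredundantApices ha
    · exact TropCone.exists_isIJVertex_of_isNonredundantRep hΓ hI hI' hIΓ
  exact ⟨⟨J, j, hJ.nonempty, hJ.proper, hJ.notMem, hJ⟩, hJ.isCellVertex⟩
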